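/- For each $n$ let $P_{X,Y}=P^{(n)}_{X,Y}$ be a probability measure on a product of measurable spaces $\mathcal X_n\times\mathcal Y_n$ with marginals $P_X,P_Y$ (all of this may depend on $n$), and let $m=m_n\le n$. From data $\mathbf X=(X_1,\dots,X_n)$, $\mathbf Y=(Y_1,\dots,Y_m)$ one tests $$\mathcal H_0:\ (\mathbf X,\mathbf Y)\sim P_X^{\otimes n}\otimes P_Y^{\otimes m}$$ against $\mathcal H_1$: for a uniformly random injection $\pi:[m]\to[n]$, conditionally on $\pi$, the pairs $(X_{\pi(i)},Y_i)$, $i\in[m]$, are i.i.d. from $P_{X,Y}$ and, independently of them, the $X_j$, $j\in[n]\setminus\pi([m])$, are i.i.d. from $P_X$. Write $\mathbb P_0,\mathbb P_1$ for the laws of $(\mathbf X,\mathbf Y)$ under $\mathcal H_0,\mathcal H_1$. Let $I_{\chi^2}(X;Y)=\chi^2(P_{X,Y}\|P_X\otimes P_Y)$, where $\chi^2(P\|Q)=\int(\frac{dP}{dQ}-1)^2\,dQ$ if $P\ll Q$ and $\infty$ otherwise, and let $$\rho(X;Y)=\sup\{\mathbb E_{P_{X,Y}}[g(X)h(Y)]:\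 \mathbb E g(X)=\mathbb E h(Y)=0,\ \mathbb E g(X)^2=\mathbb E h(Y)^2=1\}$$ be the maximal correlation ($0$ if there are no such $g,h$). Assume $I_{\chi^2}(X;Y)<\infty$ for every $n$, and let $$\frac{dP_{X,Y}}{d(P_X\otimes P_Y)}(x,y)=\sum_{k\ge0}\lambda_k\phi_k(x)\psi_k(y)\quad\text{in }L^2(P_X\otimes P_Y)$$ be a singular value decomposition, with $1=\lambda_0\ge\lambda_1\ge\dots\ge0$, $\phi_0=\psi_0=1$, and $(\phi_k)$, $(\psi_k)$, over the indices with $\lambda_k\ne0$, orthonormal in $L^2(P_X)$ and $L^2(P_Y)$ respectively (at the indices with $\lambda_k=0$ the functions $\phi_k,\psi_k$ are arbitrary square-integrable functions). Put $$T_{\rm top}=\Big(\frac1{\sqrt n}\sum_{i=1}^n\phi_1(X_i)-\frac1{\sqrt m}\sum_{i=1}^m\psi_1(Y_i)\Big)^2 .$$ Theorem. Suppose that $m=(1-o(1))n$, that $\lim_{n\to\infty}\rho(X;Y)=1$, and that either $\mathbb E_{P_X}|\phi_1(X)|^3=o(\sqrt n)$ or $\mathbb E_{P_Y}|\psi_1(Y)|^3=o(\sqrt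 m)$. Then $T_{\rm top}$ achieves strong detection: there are thresholds $\tau_n$ such that the test which rejects $\mathcal H_0$ when $T_{\rm top}<\tau_n$ has vanishing error probabilities, $$\mathbb P_0\{T_{\rm top}<\tau_n\}\to0\quad\text{and}\quad\mathbb P_1\{T_{\rm top}\ge\tau_n\}\to0\qquad(n\to\infty).$$ -/

import Mathlib

open MeasureTheory Filter Topology
open scoped ENNReal

namespace BrokenSample

noncomputable section

/-- The `χ²`-divergence `χ²(P‖Q) = ∫ (dP/dQ - 1)² dQ` if `P ≪ Q`, and `∞` otherwise. -/
def chiSqDiv {Ω : Type*} [MeasurableSpace Ω] (P Q : Measure Ω) : ℝ≥0∞ :=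
  open Classical in
  if P ≪ Q then ∫⁻ z, ENNReal.ofReal (((P.rnDeriv Q z).toReal - 1) ^ 2) ∂Q else ∞

/-- Absolute third moment `E|f|³`, with values in `[0, ∞]`. -/
def thirdAbsMoment {Ω : Type*} [MeasurableSpace Ω] (μ : Measure Ω) (f : Ω → ℝ) : ℝ≥0∞ :=
  ∫⁻ x, ‖f x‖ₑ ^ 3 ∂μ

section Pair

variable {𝒳 𝒴 : Type*} [MeasurableSpace 𝒳] [MeasurableSpace 𝒴]

/-- `χ²`-information of a joint law `P`: the `χ²`-divergence of `P` from the product of its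
marginals `P.fst` and `P.snd`. -/
def chiSqInfo (P : Measure (𝒳 × 𝒴)) : ℝ≥0∞ :=
  chiSqDiv P (P.fst.prod P.snd)

/-- Hirschfeld–Gebelein–Rényi maximal correlation: the supremum of `E[g(X) h(Y)]` over all `g`, `h`
with `E g(X) = E h(Y) = 0` and `E g(X)² = E h(Y)² = 1`. (It is `0` if there are none.) -/
def maximalCorrelation (P : Measure (𝒳 × 𝒴)) : ℝ :=
  sSup {r : ℝ | ∃ (g : 𝒳 → ℝ) (h : 𝒴 → ℝ),
    MemLp g 2 P.fst ∧ MemLp h 2 P.snd ∧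
    ∫ x, g x ∂P.fst = 0 ∧ ∫ y, h y ∂P.snd = 0 ∧
    ∫ x, g x ^ 2 ∂P.fst = 1 ∧ ∫ y, h y ^ 2 ∂P.snd = 1 ∧
    r = ∫ z, g z.1 * h z.2 ∂P}

/-- The likelihood ratio `L = dP_{XY} / d(P_X ⊗ P_Y)`. -/
def likelihoodRatio (P : Measure (𝒳 × 𝒴)) (z : 𝒳 × 𝒴) : ℝ :=
  (P.rnDeriv (P.fst.prod P.snd) z).toReal

/-- `(lam, φ, ψ)` is a singular value decomposition `L(x,y) = ∑ₖ λₖ φₖ(x) ψₖ(y)` of the likelihood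
ratio, convergent in `L²(P_X ⊗ P_Y)`, with `λ₀ = 1 ≥ λ₁ ≥ λ₂ ≥ ⋯ ≥ 0` and `φ₀ = ψ₀ = 1`.
Orthonormality is asked for at the indices with `λₖ ≠ 0` only, so that finite-dimensional (and
non-separable) `L²` spaces are covered too: a finite decomposition is continued by `λₖ = 0`, and the
functions `φₖ`, `ψₖ` of those indices do not matter. Orthonormal bases of `L²(P_X)` and `L²(P_Y)`
satisfy this a fortiori. -/
structure IsSingularSystem (P : Measure (𝒳 × 𝒴)) (lam : ℕ → ℝ) (φ : ℕ → 𝒳 → ℝ)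
    (ψ : ℕ → 𝒴 → ℝ) : Prop where
  lam_nonneg : ∀ k, 0 ≤ lam k
  lam_antitone : Antitone lam
  lam_zero : lam 0 = 1
  measurable_left : ∀ k, Measurable (φ k)
  measurable_right : ∀ k, Measurable (ψ k)
  memLp_left : ∀ k, MemLp (φ k) 2 P.fst
  memLp_right : ∀ k, MemLp (ψ k) 2 P.snd
  left_zero : φ 0 =ᵐ[P.fst] fun _ => 1
  right_zero : ψ 0 =ᵐ[P.snd] fun _ => 1
  orthonormal_left : ∀ j k, lam j ≠ 0 → lam k ≠ 0 →
    ∫ x, φ j x * φ k x ∂P.fst = if j = k then 1 else 0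
  orthonormal_right : ∀ j k, lam j ≠ 0 → lam k ≠ 0 →
    ∫ y, ψ j y * ψ k y ∂P.snd = if j = k then 1 else 0
  expansion : Tendsto
    (fun K : ℕ => eLpNorm
      (fun z : 𝒳 × 𝒴 => likelihoodRatio P z - ∑ k ∈ Finset.range K, lam k * φ k z.1 * ψ k z.2)
      2 (P.fst.prod P.snd))
    atTop (𝓝 0)

/-- The law of `(X₁,…,Xₙ), (Y₁,…,Yₘ)` under `H₀`: `P_X^{⊗n} ⊗ P_Y^{⊗m}`. -/
def nullLaw (P : Measure (𝒳 × 𝒴)) (n m : ℕ) : Measure ((Fin n → 𝒳) × (Fin m → 𝒴)) :=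
  (Measure.pi fun _ => P.fst).prod (Measure.pi fun _ => P.snd)

/-- Given an injection `π`, assembles the data sets from the `m` pairs `z i = (X_{π(i)}, Y_i)` and
the unpaired observations `w j = X_j`, `j ∉ π([m])`. -/
def assemble {n m : ℕ} (π : Fin m ↪ Fin n)
    (zw : (Fin m → 𝒳 × 𝒴) × ({j : Fin n // ¬ ∃ i, π i = j} → 𝒳)) :
    (Fin n → 𝒳) × (Fin m → 𝒴) :=
  (fun j => if h : ∃ i, π i = j then (zw.1 h.choose).1 else zw.2 ⟨j, h⟩, fun i => (zw.1 i).2)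

/-- The law under `H₁` conditional on `π`: the pairs `(X_{π(i)}, Y_i)` are i.i.d. from `P`, and
independently the remaining `X_j` are i.i.d. from `P_X`. -/
def plantedLawGiven (P : Measure (𝒳 × 𝒴)) {n m : ℕ} (π : Fin m ↪ Fin n) :
    Measure ((Fin n → 𝒳) × (Fin m → 𝒴)) :=
  ((Measure.pi fun _ : Fin m => P).prod
    (Measure.pi fun _ : {j : Fin n // ¬ ∃ i, π i = j} => P.fst)).map (assemble π)

/-- The law under `H₁`: the mixture of the conditional laws over a uniformly random injection
`π : [m] → [n]`. -/
def plantedLaw (P : Measure (𝒳 × 𝒴)) (n m : ℕ) : Measure ((Fin n → 𝒳) × (Fin m → 𝒴)) :=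
  (Fintype.card (Fin m ↪ Fin n) : ℝ≥0∞)⁻¹ • ∑ π : Fin m ↪ Fin n, plantedLawGiven P π

/-- `T_top = (n^{-1/2} ∑ᵢ φ(Xᵢ) - m^{-1/2} ∑ᵢ ψ(Yᵢ))²`. -/
def topStatistic (φ : 𝒳 → ℝ) (ψ : 𝒴 → ℝ) (n m : ℕ) (D : (Fin n → 𝒳) × (Fin m → 𝒴)) : ℝ :=
  ((√(n : ℝ))⁻¹ * ∑ i, φ (D.1 i) - (√(m : ℝ))⁻¹ * ∑ i, ψ (D.2 i)) ^ 2

end Pair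

/-- The statistics `T n`, applied to samples of sizes `n` and `m n` from `P n`, achieve strong
detection: for suitable thresholds `τ n`, the test which rejects `H₀` if `T n < τ n` has Type-I and
Type-II error probabilities tending to zero. -/
def AchievesStrongDetection {𝒳 𝒴 : ℕ → Type*} [∀ n, MeasurableSpace (𝒳 n)]
    [∀ n, MeasurableSpace (𝒴 n)] (P : ∀ n, Measure (𝒳 n × 𝒴 n)) (m : ℕ → ℕ)
    (T : ∀ n, (Fin n → 𝒳 n) × (Fin (m n) → 𝒴 n) → ℝ) : Prop :=
  ∃ τ : ℕ → ℝ,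
    Tendsto (fun n => nullLaw (P n) n (m n) {D | T n D < τ n}) atTop (𝓝 0) ∧
    Tendsto (fun n => plantedLaw (P n) n (m n) {D | τ n ≤ T n D}) atTop (𝓝 0)

end

end BrokenSample

/-! Write `T_top = S²`, where `S` is the difference of the two normalised sums. Under `H₁` each
matched pair contributes two terms with correlation `λ₁`, so `S` has mean 0 and variance `2 - 2
√(m/n) λ₁`. Since `ρ ≤ λ₁ ≤ 1` (`IsSingularSystem.maximalCorrelation_le`), this variance tends to 0,
and Chebyshev's inequality (`plantedLaw_sq_ge_le`) shows that `S²` is small.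

Under `H₀` it must be shown that `S` does not concentrate at 0. The two sums are independent, so the
characteristic function of `S` is a product, bounded in modulus by either factor; this is why a
moment condition on one side suffices. With `k` the sample size of that side and `β` its third
absolute moment, the factor is at most `exp (-t² / 3)` for `|t| ≤ √k / (4 (β + 1))`. Gaussian
smoothing turns this into a bound of order `√τ + r² / τ` on the probability of `S² < τ`, where `r =
(β + 1) / √k → 0` (`measureReal_sq_lt_le_of_charFun_le_pow`). No limit law for `S` is needed: it
suffices that `τ → 0` more slowly than the variance and than `r²`. -/

open ProbabilityTheory

namespace BrokenSample

/-! ### Small ball probabilities from characteristic functions. -/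

section SmallBall

variable {Ω : Type*} [MeasurableSpace Ω]

/-- Second-order Taylor bound for `x ↦ exp (i x)`. -/
theorem norm_exp_mul_I_sub_taylor_le (x : ℝ) :
    ‖Complex.exp (x * Complex.I) - (1 + x * Complex.I - x ^ 2 / 2)‖ ≤ 2 / 3 * |x| ^ 3 := by
  -- The fourth-order bound serves for `|x| ≤ 1`; beyond that the error is at most `x² / 2 ≤ |x|³ /
  -- 2`. Adding the sine error `|x|³ / 6` gives the constant `2/3`.
  have hcos : |Real.cos x - (1 - x ^ 2 / 2)| ≤ 1 / 2 * |x| ^ 3 := by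
    rcases le_or_gt |x| 1 with h | h
    · have h1 := Real.cos_bound h
      have h2 : |x| ^ 4 ≤ |x| ^ 3 := pow_le_pow_of_le_one (abs_nonneg x) h (by norm_num)
      have h3 : 0 ≤ |x| ^ 3 := by positivity
      linarith
    · have h1 := Real.one_sub_sq_div_two_le_cos (x := x)
      have h2 : |x| ^ 2 ≤ |x| ^ 3 := pow_le_pow_right₀ h.le (by norm_num)
      rw [sq_abs] at h2
      rw [abs_of_nonneg (by linarith)]
      linarith [Real.cos_le_one x]
  have hsin : |Real.sin x - x| ≤ 1 / 6 * |x| ^ 3 := by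
    rcases le_total 0 x with h | h
    · rw [abs_of_nonneg h, abs_of_nonpos (by linarith [Real.sin_le h])]
      linarith [Real.sin_ge_sub_cube h]
    · have h' : 0 ≤ -x := by linarith
      have h1 := Real.sin_le h'
      have h2 := Real.sin_ge_sub_cube h'
      rw [Real.sin_neg] at h1 h2
      rw [abs_of_nonpos h, abs_of_nonneg (by linarith)]
      linarith
  have heq : Complex.exp (x * Complex.I) - (1 + x * Complex.I - x ^ 2 / 2) =
      ((Real.cos x - (1 - x ^ 2 / 2) : ℝ) : ℂ) + ((Real.sin x - x : ℝ) : ℂ) * Complex.I := by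
    rw [Complex.exp_mul_I]
    push_cast
    ring
  rw [heq]
  refine (norm_add_le _ _).trans ?_
  rw [norm_mul, Complex.norm_I, Complex.norm_real, Complex.norm_real, Real.norm_eq_abs,
    Real.norm_eq_abs]
  linarith

theorem integrable_exp_mul_I {μ : Measure Ω} [IsFiniteMeasure μ] {f : Ω → ℝ}
    (hf : Measurable f) (s : ℝ) :
    Integrable (fun ω => Complex.exp ((s * f ω : ℝ) * Complex.I)) μ := by
  refine Integrable.of_bound (C := 1) (by fun_prop) (ae_of_all _ fun ω => ?_)
  rw [Complex.norm_exp_ofReal_mul_I]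

/-- The characteristic function of a standardized variable with finite third moment is at most
`exp (-s² / 3)` near the origin. -/
theorem norm_integral_exp_le_of_thirdMoment {μ : Measure Ω} [IsProbabilityMeasure μ] {f : Ω → ℝ}
    (hf : Measurable f) (hf2 : MemLp f 2 μ) (hf3 : Integrable (fun ω => |f ω| ^ 3) μ)
    (h0 : ∫ ω, f ω ∂μ = 0) (h1 : ∫ ω, f ω ^ 2 ∂μ = 1) {s : ℝ}
    (hs : |s| * (∫ ω, |f ω| ^ 3 ∂μ + 1) ≤ 1 / 4) :
    ‖∫ ω, Complex.exp ((s * f ω : ℝ) * Complex.I) ∂μ‖ ≤ Real.exp (-(s ^ 2 / 3)) := by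
  set β := ∫ ω, |f ω| ^ 3 ∂μ with hβ
  have hβ0 : 0 ≤ β := integral_nonneg fun ω => by positivity
  have hi1 : Integrable f μ := hf2.integrable (by norm_num)
  have hi2 : Integrable (fun ω => f ω ^ 2) μ := hf2.integrable_sq
  have hR : Integrable (fun ω => (1 : ℂ) + (s * f ω : ℝ) * Complex.I -
      ((s * f ω : ℝ) : ℂ) ^ 2 / 2) μ := by
    refine ((integrable_const _).add ((hi1.const_mul s).ofReal.mul_const _)).sub ?_
    refine Integrable.div_const ?_ 2
    have : Integrable (fun ω => ((s ^ 2 * f ω ^ 2 : ℝ) : ℂ)) μ := (hi2.const_mul (s ^ 2)).ofReal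
    refine this.congr (ae_of_all _ fun ω => ?_)
    push_cast
    ring
  have hval : ∫ ω, ((1 : ℂ) + (s * f ω : ℝ) * Complex.I - ((s * f ω : ℝ) : ℂ) ^ 2 / 2) ∂μ =
      ((1 - s ^ 2 / 2 : ℝ) : ℂ) := by
    have e : ∀ ω, ((1 : ℂ) + (s * f ω : ℝ) * Complex.I - ((s * f ω : ℝ) : ℂ) ^ 2 / 2) =
        ((1 - s ^ 2 / 2 * f ω ^ 2 : ℝ) : ℂ) + ((s * f ω : ℝ) : ℂ) * Complex.I := fun ω => by
      push_cast
      ring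
    simp_rw [e]
    rw [integral_add, integral_mul_const, integral_complex_ofReal, integral_complex_ofReal, integral_sub,
      integral_const_mul, integral_const_mul, h0, h1]
    · simp
    · exact integrable_const _
    · exact hi2.const_mul _
    · exact ((integrable_const _).sub (hi2.const_mul _)).ofReal
    · exact (hi1.const_mul s).ofReal.mul_const _
  have hdiff : ‖(∫ ω, Complex.exp ((s * f ω : ℝ) * Complex.I) ∂μ) - ((1 - s ^ 2 / 2 : ℝ) : ℂ)‖ ≤
      2 / 3 * |s| ^ 3 * β := by
    rw [← hval, ← integral_sub (integrable_exp_mul_I hf s) hR, hβ, ← integral_const_mul]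
    refine norm_integral_le_of_norm_le (hf3.const_mul _) (ae_of_all _ fun ω => ?_)
    refine (norm_exp_mul_I_sub_taylor_le (s * f ω)).trans_eq ?_
    rw [abs_mul]
    ring
  -- The `+ 1` in the hypothesis on `s` keeps `s` bounded, so that `1 - s² / 2` is nonnegative and
  -- equals its own norm.
  have hs1 : |s| ≤ 1 := by nlinarith [abs_nonneg s, mul_nonneg (abs_nonneg s) hβ0]
  have hsβ : |s| * β ≤ 1 / 4 := by nlinarith [abs_nonneg s]
  have hs2 : s ^ 2 ≤ 1 := by rw [← sq_abs]; nlinarith [abs_nonneg s]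
  have h3 : |s| ^ 3 * β ≤ s ^ 2 * (1 / 4) := by
    rw [← sq_abs s]
    calc |s| ^ 3 * β = |s| ^ 2 * (|s| * β) := by ring
      _ ≤ _ := by gcongr
  have h4 : ‖((1 - s ^ 2 / 2 : ℝ) : ℂ)‖ = 1 - s ^ 2 / 2 := by
    rw [Complex.norm_real, Real.norm_eq_abs, abs_of_nonneg (by linarith)]
  -- The Taylor error is at most `(2/3)(s² / 4) = s² / 6`, and `1 - s² / 2 + s² / 6 = 1 - s² / 3`.
  have h5 := Real.add_one_le_exp (-(s ^ 2 / 3))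
  linarith [norm_sub_norm_le (∫ ω, Complex.exp ((s * f ω : ℝ) * Complex.I) ∂μ)
    (((1 - s ^ 2 / 2 : ℝ) : ℂ))]

/-- A Gaussian kernel is the characteristic function of a Gaussian law; averaged over `x = S`, it
becomes an average of the characteristic function of `S`. -/
theorem exp_neg_sq_eq_integral_gaussianReal (v : NNReal) (x : ℝ) :
    Complex.exp (-(v * x ^ 2 / 2)) =
      ∫ t, Complex.exp ((t * x : ℝ) * Complex.I) ∂gaussianReal 0 v := by
  have h := charFun_gaussianReal (μ := 0) (v := v) x
  rw [charFun_apply_real] at h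
  simp only [Complex.ofReal_zero, mul_zero, zero_mul, zero_sub] at h
  rw [← h]
  simp only [Complex.ofReal_mul, mul_comm]

/-- Gaussian smoothing bounds the small ball probability at the origin by the characteristic
function. -/
theorem measureReal_sq_lt_le_integral_charFun {ρ : Measure Ω} [IsProbabilityMeasure ρ] {S : Ω → ℝ}
    (hS : Measurable S) {τ : ℝ} (hτ : 0 < τ) :
    ρ.real {ω | S ω ^ 2 < τ} ≤ Real.exp (1 / 2) *
      ∫ t, ‖∫ ω, Complex.exp ((t * S ω : ℝ) * Complex.I) ∂ρ‖ ∂gaussianReal 0 (τ⁻¹).toNNReal := by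
  set v := (τ⁻¹).toNNReal with hv
  have hvτ : (v : ℝ) = τ⁻¹ := Real.coe_toNNReal _ (by positivity)
  have hmeas : MeasurableSet {ω | S ω ^ 2 < τ} := measurableSet_lt (by fun_prop) (by fun_prop)
  have hint : Integrable (fun ω => Real.exp (-(v * S ω ^ 2 / 2))) ρ := by
    refine Integrable.of_bound (C := 1) (by fun_prop) (ae_of_all _ fun ω => ?_)
    rw [Real.norm_eq_abs, Real.abs_exp, Real.exp_le_one_iff]
    have : 0 ≤ (v : ℝ) * S ω ^ 2 := by positivity
    linarith
  -- With variance `v = 1 / τ` the kernel is at least `exp (-1/2)` on the event, whence the factor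
  -- `exp (1/2)`.
  have h1 : ρ.real {ω | S ω ^ 2 < τ} ≤
      Real.exp (1 / 2) * ∫ ω, Real.exp (-(v * S ω ^ 2 / 2)) ∂ρ := by
    rw [← integral_indicator_one hmeas, ← integral_const_mul]
    refine integral_mono ((integrable_const _).indicator hmeas) (hint.const_mul _) fun ω => ?_
    by_cases hω : S ω ^ 2 < τ
    · simp only [Set.indicator, Set.mem_ofPred_eq, hω, if_true, Pi.one_apply]
      rw [← Real.exp_add, Real.one_le_exp_iff, hvτ]
      have : τ⁻¹ * S ω ^ 2 ≤ 1 := by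
        rw [inv_mul_le_iff₀ hτ]
        linarith
      linarith
    · simp only [Set.indicator, Set.mem_ofPred_eq, hω, if_false]
      positivity
  refine h1.trans (mul_le_mul_of_nonneg_left ?_ (Real.exp_pos _).le)
  have h2 : ((∫ ω, Real.exp (-(v * S ω ^ 2 / 2)) ∂ρ : ℝ) : ℂ) =
      ∫ t, ∫ ω, Complex.exp ((t * S ω : ℝ) * Complex.I) ∂ρ ∂gaussianReal 0 v := by
    rw [integral_integral_swap, ← integral_complex_ofReal]
    · refine integral_congr_ae (ae_of_all _ fun ω => ?_)
      beta_reduce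
      rw [← exp_neg_sq_eq_integral_gaussianReal]
      push_cast
      rfl
    · refine Integrable.of_bound (C := 1) ?_ (ae_of_all _ fun ω => ?_)
      · exact Measurable.aestronglyMeasurable (by fun_prop)
      · simp only [Function.uncurry]
        rw [Complex.norm_exp_ofReal_mul_I]
  refine (le_abs_self _).trans ?_
  rw [← Real.norm_eq_abs, ← Complex.norm_real, h2]
  exact norm_integral_le_integral_norm _

/-- Gaussian average of a function dominated by `exp (-t² / 3)` on `[-R, R]` and by `1`
elsewhere. -/
theorem integral_gaussianReal_le_of_le_exp {h : ℝ → ℝ} (hmeas : Measurable h) {τ R : ℝ}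
    (hτ : 0 < τ) (hR : 0 < R) (h0 : ∀ t, 0 ≤ h t) (h1 : ∀ t, h t ≤ 1)
    (hexp : ∀ t, |t| ≤ R → h t ≤ Real.exp (-(t ^ 2 / 3))) :
    ∫ t, h t ∂gaussianReal 0 (τ⁻¹).toNNReal ≤ √(3 * τ / 2) + (R ^ 2 * τ)⁻¹ := by
  set v := (τ⁻¹).toNNReal with hv
  have hvτ : (v : ℝ) = τ⁻¹ := Real.coe_toNNReal _ (by positivity)
  have hv0 : v ≠ 0 := by
    intro h
    rw [h] at hvτ
    simp only [NNReal.coe_zero] at hvτ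
    exact (inv_pos.2 hτ).ne hvτ
  have hi1 : Integrable h (gaussianReal 0 v) := by
    refine Integrable.of_bound (C := 1) (by fun_prop) (ae_of_all _ fun t => ?_)
    rw [Real.norm_eq_abs, abs_of_nonneg (h0 t)]
    exact h1 t
  have hi2 : Integrable (fun t => Real.exp (-(t ^ 2 / 3))) (gaussianReal 0 v) := by
    refine Integrable.of_bound (C := 1) (by fun_prop) (ae_of_all _ fun t => ?_)
    rw [Real.norm_eq_abs, Real.abs_exp, Real.exp_le_one_iff]
    linarith [sq_nonneg t]
  have hi3 : Integrable (fun t : ℝ => t ^ 2) (gaussianReal 0 v) :=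
    (memLp_id_gaussianReal 2).integrable_sq
  have hvar : ∫ t : ℝ, t ^ 2 ∂gaussianReal 0 v = v := by
    have := variance_fun_id_gaussianReal (μ := 0) (v := v)
    rw [variance_eq_integral (by fun_prop), integral_id_gaussianReal] at this
    simpa using this
  -- Outside `[-R, R]` the trivial bound 1 is at most `t² / R²`, whose Gaussian mean is `v / R² = 1
  -- / (R² τ)`.
  have hpt : ∀ t, h t ≤ Real.exp (-(t ^ 2 / 3)) + (R ^ 2)⁻¹ * t ^ 2 := fun t => by
    rcases le_or_gt |t| R with ht | ht
    · have : 0 ≤ (R ^ 2)⁻¹ * t ^ 2 := by positivity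
      linarith [hexp t ht]
    · have : 1 ≤ (R ^ 2)⁻¹ * t ^ 2 := by
        rw [← sq_abs t, le_inv_mul_iff₀ (by positivity), mul_one]
        gcongr
      linarith [h1 t, Real.exp_pos (-(t ^ 2 / 3))]
  -- The density is bounded by its peak `√(τ / (2π))`, and `∫ exp (-t² / 3) dt = √(3π)`.
  have hG : ∫ t, Real.exp (-(t ^ 2 / 3)) ∂gaussianReal 0 v ≤ √(3 * τ / 2) := by
    rw [integral_gaussianReal_eq_integral_smul hv0]
    have hgi : Integrable fun t : ℝ => Real.exp (-(1 / 3) * t ^ 2) :=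
      integrable_exp_neg_mul_sq (by norm_num)
    have hle : ∫ t, gaussianPDFReal 0 v t • Real.exp (-(t ^ 2 / 3)) ≤
        ∫ t, (√(2 * Real.pi * v))⁻¹ * Real.exp (-(1 / 3) * t ^ 2) := by
      refine integral_mono_of_nonneg (ae_of_all _ fun t => ?_) (hgi.const_mul _)
        (ae_of_all _ fun t => ?_)
      · exact mul_nonneg (gaussianPDFReal_nonneg _ _ _) (Real.exp_pos _).le
      · simp only [smul_eq_mul]
        rw [show -(1 / 3) * t ^ 2 = -(t ^ 2 / 3) by ring]
        refine mul_le_mul_of_nonneg_right ?_ (Real.exp_pos _).le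
        rw [gaussianPDFReal]
        refine mul_le_of_le_one_right (by positivity) (Real.exp_le_one_iff.2 ?_)
        rw [neg_div]
        exact neg_nonpos.2 (by positivity)
    refine hle.trans_eq ?_
    rw [integral_const_mul, integral_gaussian, hvτ, ← Real.sqrt_inv, ← Real.sqrt_mul (by positivity)]
    congr 1
    have := Real.pi_ne_zero
    field_simp
  calc ∫ t, h t ∂gaussianReal 0 v
      ≤ ∫ t, (Real.exp (-(t ^ 2 / 3)) + (R ^ 2)⁻¹ * t ^ 2) ∂gaussianReal 0 v :=
        integral_mono hi1 (hi2.add (hi3.const_mul _)) hpt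
    _ = ∫ t, Real.exp (-(t ^ 2 / 3)) ∂gaussianReal 0 v + (R ^ 2)⁻¹ * v := by
        rw [integral_add hi2 (hi3.const_mul _), integral_const_mul, hvar]
    _ ≤ √(3 * τ / 2) + (R ^ 2 * τ)⁻¹ := by
        rw [mul_inv, hvτ]
        gcongr

/-- Small ball bound for a variable whose characteristic function is dominated by that of a
normalized sum of `k` i.i.d. standardized variables. -/
theorem measureReal_sq_lt_le_of_charFun_le_pow {Ω' : Type*} [MeasurableSpace Ω']
    {ρ : Measure Ω} [IsProbabilityMeasure ρ] {S : Ω → ℝ} (hS : Measurable S)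
    {μ : Measure Ω'} [IsProbabilityMeasure μ] {f : Ω' → ℝ}
    (hf : Measurable f) (hf2 : MemLp f 2 μ) (hf3 : Integrable (fun ω => |f ω| ^ 3) μ)
    (h0 : ∫ ω, f ω ∂μ = 0) (h1 : ∫ ω, f ω ^ 2 ∂μ = 1) {k : ℕ} (hk : 0 < k) {c : ℝ}
    (hc : c ^ 2 = (k : ℝ)⁻¹)
    (hle : ∀ t : ℝ, ‖∫ ω, Complex.exp ((t * S ω : ℝ) * Complex.I) ∂ρ‖ ≤
      ‖∫ ω, Complex.exp ((t * c * f ω : ℝ) * Complex.I) ∂μ‖ ^ k)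
    {τ : ℝ} (hτ : 0 < τ) :
    ρ.real {ω | S ω ^ 2 < τ} ≤ Real.exp (1 / 2) *
      (√(3 * τ / 2) + 16 * (((∫ ω, |f ω| ^ 3 ∂μ) + 1) / √k) ^ 2 / τ) := by
  set β := ∫ ω, |f ω| ^ 3 ∂μ with hβ
  have hβ0 : 0 ≤ β := integral_nonneg fun ω => by positivity
  have hk' : (0 : ℝ) < k := by exact_mod_cast hk
  refine (measureReal_sq_lt_le_integral_charFun hS hτ).trans
    (mul_le_mul_of_nonneg_left ?_ (Real.exp_pos _).le)
  have hmeas : Measurable fun t : ℝ => ‖∫ ω, Complex.exp ((t * S ω : ℝ) * Complex.I) ∂ρ‖ := by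
    have : StronglyMeasurable fun p : ℝ × Ω => Complex.exp ((p.1 * S p.2 : ℝ) * Complex.I) :=
      Measurable.stronglyMeasurable (by fun_prop)
    exact this.integral_prod_right'.measurable.norm
  -- This is the largest `R` for which `|t| ≤ R` gives `|t c| (β + 1) ≤ 1/4`; `1 / R²` produces the
  -- factor 16.
  have hR : 0 < √k / (4 * (β + 1)) := by positivity
  have hkey := integral_gaussianReal_le_of_le_exp hmeas hτ hR (fun t => norm_nonneg _) (fun t => ?_)
    (fun t ht => ?_)
  · refine hkey.trans_eq ?_
    congr 1
    field_simp
    norm_num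
  · refine (norm_integral_le_of_norm_le_const (C := 1) (ae_of_all _ fun ω => ?_)).trans_eq (by simp)
    rw [Complex.norm_exp_ofReal_mul_I]
  · refine (hle t).trans ?_
    have hcs : |c| = (√k)⁻¹ := by
      rw [← Real.sqrt_sq_eq_abs, hc, Real.sqrt_inv]
    have hs : |t * c| * (β + 1) ≤ 1 / 4 := by
      rw [abs_mul, hcs]
      calc |t| * (√k)⁻¹ * (β + 1) ≤ √k / (4 * (β + 1)) * (√k)⁻¹ * (β + 1) := by gcongr
        _ = 1 / 4 := by
          have : √(k : ℝ) ≠ 0 := (Real.sqrt_pos.2 hk').ne'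
          field_simp
    refine (pow_le_pow_left₀ (norm_nonneg _)
      (norm_integral_exp_le_of_thirdMoment hf hf2 hf3 h0 h1 hs) k).trans_eq ?_
    rw [← Real.exp_nat_mul, mul_pow, hc]
    congr 1
    field_simp

end SmallBall

/-! ### Bessel and Cauchy–Schwarz inequalities in `L²`. -/

section SquareIntegrable

variable {Ω : Type*} [MeasurableSpace Ω] {μ : Measure Ω}

theorem inner_toLp_toLp {f g : Ω → ℝ} (hf : MemLp f 2 μ) (hg : MemLp g 2 μ) :
    inner ℝ (hf.toLp f) (hg.toLp g) = ∫ ω, f ω * g ω ∂μ := by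
  rw [L2.inner_def]
  refine integral_congr_ae ?_
  filter_upwards [hf.coeFn_toLp, hg.coeFn_toLp] with ω h1 h2
  rw [h1, h2]
  simp [mul_comm]

/-- Bessel's inequality for square-integrable functions. -/
theorem sum_sq_integral_mul_le {ι : Type*} [DecidableEq ι] {f : ι → Ω → ℝ} (s : Finset ι)
    (hf : ∀ i, MemLp (f i) 2 μ)
    (horth : ∀ i ∈ s, ∀ j ∈ s, ∫ ω, f i ω * f j ω ∂μ = if i = j then 1 else 0)
    {g : Ω → ℝ} (hg : MemLp g 2 μ) :
    ∑ i ∈ s, (∫ ω, f i ω * g ω ∂μ) ^ 2 ≤ ∫ ω, g ω ^ 2 ∂μ := by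
  have hv : Orthonormal ℝ fun i : s => (hf i).toLp (f i) := by
    rw [orthonormal_iff_ite]
    intro i j
    rw [inner_toLp_toLp, horth i i.2 j j.2]
    simp only [Subtype.ext_iff]
  have h := hv.sum_inner_products_le (hg.toLp g) (s := Finset.univ)
  rw [← real_inner_self_eq_norm_sq, inner_toLp_toLp] at h
  simp_rw [inner_toLp_toLp, Real.norm_eq_abs, sq_abs] at h
  rw [Finset.univ_eq_attach, Finset.sum_attach s fun i => (∫ ω, f i ω * g ω ∂μ) ^ 2] at h
  simpa only [sq] using h

theorem enorm_integral_mul_le_eLpNorm {f g : Ω → ℝ} (hf : AEStronglyMeasurable f μ)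
    (hg : AEStronglyMeasurable g μ) :
    ‖∫ ω, f ω * g ω ∂μ‖ₑ ≤ eLpNorm f 2 μ * eLpNorm g 2 μ := by
  refine (enorm_integral_le_lintegral_enorm _).trans ?_
  rw [← eLpNorm_one_eq_lintegral_enorm]
  change eLpNorm (f • g) 1 μ ≤ _
  exact eLpNorm_smul_le_mul_eLpNorm hg hf

theorem memLp_two_mul_prod {Ω' : Type*} [MeasurableSpace Ω'] {ν : Measure Ω'} [SFinite μ] [SFinite ν]
    {f : Ω → ℝ} {g : Ω' → ℝ} (hf : MemLp f 2 μ) (hg : MemLp g 2 ν) :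
    MemLp (fun z : Ω × Ω' => f z.1 * g z.2) 2 (μ.prod ν) := by
  have hm : AEStronglyMeasurable (fun z : Ω × Ω' => f z.1 * g z.2) (μ.prod ν) :=
    hf.1.comp_fst.mul hg.1.comp_snd
  rw [memLp_two_iff_integrable_sq hm]
  simp_rw [mul_pow]
  exact hf.integrable_sq.mul_prod hg.integrable_sq

end SquareIntegrable

/-! ### Singular values and maximal correlation. -/

section Spectrum

variable {𝒳 𝒴 : Type*} [MeasurableSpace 𝒳] [MeasurableSpace 𝒴]
  {P : Measure (𝒳 × 𝒴)}

theorem absolutelyContinuous_of_chiSqInfo_lt_top (h : chiSqInfo P < ∞) :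
    P ≪ P.fst.prod P.snd := by
  by_contra hP
  simp [chiSqInfo, chiSqDiv, hP] at h

variable {lam : ℕ → ℝ} {φ : ℕ → 𝒳 → ℝ} {ψ : ℕ → 𝒴 → ℝ}

theorem IsSingularSystem.lam_le_one (h : IsSingularSystem P lam φ ψ) (k : ℕ) : lam k ≤ 1 :=
  (h.lam_antitone (Nat.zero_le k)).trans_eq h.lam_zero

theorem IsSingularSystem.integral_left (h : IsSingularSystem P lam φ ψ) (h1 : lam 1 ≠ 0) :
    ∫ x, φ 1 x ∂P.fst = 0 := by
  have h0 := h.orthonormal_left 0 1 (by rw [h.lam_zero]; exact one_ne_zero) h1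
  rw [if_neg (by norm_num)] at h0
  rw [← h0]
  refine integral_congr_ae ?_
  filter_upwards [h.left_zero] with x hx
  rw [hx, one_mul]

theorem IsSingularSystem.integral_right (h : IsSingularSystem P lam φ ψ) (h1 : lam 1 ≠ 0) :
    ∫ y, ψ 1 y ∂P.snd = 0 := by
  have h0 := h.orthonormal_right 0 1 (by rw [h.lam_zero]; exact one_ne_zero) h1
  rw [if_neg (by norm_num)] at h0
  rw [← h0]
  refine integral_congr_ae ?_
  filter_upwards [h.right_zero] with x hx
  rw [hx, one_mul]

theorem IsSingularSystem.integral_sq_left (h : IsSingularSystem P lam φ ψ) (h1 : lam 1 ≠ 0) :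
    ∫ x, φ 1 x ^ 2 ∂P.fst = 1 := by
  simpa [sq] using h.orthonormal_left 1 1 h1 h1

theorem IsSingularSystem.integral_sq_right (h : IsSingularSystem P lam φ ψ) (h1 : lam 1 ≠ 0) :
    ∫ y, ψ 1 y ^ 2 ∂P.snd = 1 := by
  simpa [sq] using h.orthonormal_right 1 1 h1 h1

variable [IsProbabilityMeasure P]

theorem IsSingularSystem.memLp_partialSum (h : IsSingularSystem P lam φ ψ) (K : ℕ) :
    MemLp (fun z : 𝒳 × 𝒴 => ∑ k ∈ Finset.range K, lam k * φ k z.1 * ψ k z.2) 2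
      (P.fst.prod P.snd) := by
  refine memLp_finsetSum _ fun k _ => ?_
  simp_rw [mul_assoc]
  exact (memLp_two_mul_prod (h.memLp_left k) (h.memLp_right k)).const_mul _

theorem measurable_likelihoodRatio (P : Measure (𝒳 × 𝒴)) : Measurable (likelihoodRatio P) :=
  (Measure.measurable_rnDeriv _ _).ennreal_toReal

theorem IsSingularSystem.memLp_likelihoodRatio (h : IsSingularSystem P lam φ ψ) :
    MemLp (likelihoodRatio P) 2 (P.fst.prod P.snd) := by
  obtain ⟨K, hK⟩ := (h.expansion.eventually (gt_mem_nhds ENNReal.zero_lt_top)).exists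
  have h1 : MemLp (fun z : 𝒳 × 𝒴 => likelihoodRatio P z -
      ∑ k ∈ Finset.range K, lam k * φ k z.1 * ψ k z.2) 2 (P.fst.prod P.snd) :=
    ⟨(measurable_likelihoodRatio P).aestronglyMeasurable.sub (h.memLp_partialSum K).1, hK⟩
  refine (h1.add (h.memLp_partialSum K)).ae_eq (ae_of_all _ fun z => ?_)
  simp

/-- The correlation of `g(X)` and `h(Y)` in terms of the singular value decomposition. -/
theorem IsSingularSystem.tendsto_sum_integral_mul (h : IsSingularSystem P lam φ ψ)
    (hac : P ≪ P.fst.prod P.snd) {f : 𝒳 → ℝ} {g : 𝒴 → ℝ} (hf : MemLp f 2 P.fst)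
    (hg : MemLp g 2 P.snd) :
    Tendsto (fun K => ∑ k ∈ Finset.range K,
      lam k * (∫ x, φ k x * f x ∂P.fst) * ∫ y, ψ k y * g y ∂P.snd) atTop
      (𝓝 (∫ z, f z.1 * g z.2 ∂P)) := by
  have hfg := memLp_two_mul_prod hf hg
  -- Absolute continuity turns the correlation into an `L²` pairing with the likelihood ratio;
  -- Cauchy–Schwarz then transfers the `L²` convergence of the expansion.
  have hL : ∫ z, f z.1 * g z.2 ∂P =
      ∫ z, likelihoodRatio P z * (f z.1 * g z.2) ∂P.fst.prod P.snd :=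
    (integral_toReal_rnDeriv_mul hac).symm
  rw [tendsto_iff_edist_tendsto_0]
  have hlim : Tendsto (fun K => eLpNorm (fun z : 𝒳 × 𝒴 => likelihoodRatio P z -
      ∑ k ∈ Finset.range K, lam k * φ k z.1 * ψ k z.2) 2 (P.fst.prod P.snd) *
      eLpNorm (fun z : 𝒳 × 𝒴 => f z.1 * g z.2) 2 (P.fst.prod P.snd)) atTop (𝓝 0) := by
    simpa using ENNReal.Tendsto.mul_const h.expansion (Or.inr hfg.2.ne)
  refine tendsto_of_tendsto_of_tendsto_of_le_of_le tendsto_const_nhds hlim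
    (fun _ => zero_le) fun K => ?_
  have hsum : ∑ k ∈ Finset.range K,
      lam k * (∫ x, φ k x * f x ∂P.fst) * ∫ y, ψ k y * g y ∂P.snd =
      ∫ z, (∑ k ∈ Finset.range K, lam k * φ k z.1 * ψ k z.2) * (f z.1 * g z.2)
        ∂P.fst.prod P.snd := by
    simp_rw [Finset.sum_mul]
    rw [integral_finsetSum]
    · refine Finset.sum_congr rfl fun k _ => ?_
      rw [mul_assoc, ← integral_prod_mul, ← integral_const_mul]
      refine integral_congr_ae (ae_of_all _ fun z => ?_)
      simp only
      ring
    · intro k _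
      refine MemLp.integrable_mul (p := 2) (q := 2) ?_ hfg
      simp_rw [mul_assoc]
      exact (memLp_two_mul_prod (h.memLp_left k) (h.memLp_right k)).const_mul _
  beta_reduce
  rw [edist_comm, hsum, hL, edist_eq_enorm_sub, ← integral_sub]
  · simp_rw [← sub_mul]
    exact enorm_integral_mul_le_eLpNorm
      (h.memLp_likelihoodRatio.sub (h.memLp_partialSum K)).1 hfg.1
  · exact h.memLp_likelihoodRatio.integrable_mul hfg
  · exact (h.memLp_partialSum K).integrable_mul hfg

/-- The leading pair of singular functions has correlation `λ₁`. -/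
theorem IsSingularSystem.integral_top_mul_top (h : IsSingularSystem P lam φ ψ)
    (hac : P ≪ P.fst.prod P.snd) (h1 : lam 1 ≠ 0) :
    ∫ z, φ 1 z.1 * ψ 1 z.2 ∂P = lam 1 := by
  refine tendsto_nhds_unique
    (h.tendsto_sum_integral_mul hac (h.memLp_left 1) (h.memLp_right 1)) ?_
  refine tendsto_const_nhds.congr' ?_
  filter_upwards [eventually_ge_atTop 2] with K hK
  rw [Finset.sum_eq_single 1]
  · rw [h.orthonormal_left 1 1 h1 h1, h.orthonormal_right 1 1 h1 h1]
    simp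
  · intro k _ hk
    by_cases hl : lam k = 0
    · simp [hl]
    · rw [h.orthonormal_left k 1 hl h1]
      simp [hk]
  · intro hn
    exact absurd (Finset.mem_range.2 (by omega)) hn

/-- Centring of `f` kills the coefficient at index 0, so only singular values at most `λ₁` remain.
AM–GM on each term and Bessel's inequality on both sides bound the partial sums. -/
theorem IsSingularSystem.integral_mul_le (h : IsSingularSystem P lam φ ψ)
    (hac : P ≪ P.fst.prod P.snd) {f : 𝒳 → ℝ} {g : 𝒴 → ℝ} (hf : MemLp f 2 P.fst)
    (hg : MemLp g 2 P.snd) (hf0 : ∫ x, f x ∂P.fst = 0)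
    (hf1 : ∫ x, f x ^ 2 ∂P.fst = 1) (hg1 : ∫ y, g y ^ 2 ∂P.snd = 1) :
    ∫ z, f z.1 * g z.2 ∂P ≤ lam 1 := by
  refine le_of_tendsto (h.tendsto_sum_integral_mul hac hf hg) (Eventually.of_forall fun K => ?_)
  -- Orthonormality is available only where `λₖ ≠ 0`; the other indices contribute nothing to the
  -- correlation.
  have hl := sum_sq_integral_mul_le ((Finset.range K).filter fun k => lam k ≠ 0) h.memLp_left
    (fun i hi j hj => h.orthonormal_left i j (Finset.mem_filter.1 hi).2 (Finset.mem_filter.1 hj).2)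
    hf
  have hr := sum_sq_integral_mul_le ((Finset.range K).filter fun k => lam k ≠ 0) h.memLp_right
    (fun i hi j hj => h.orthonormal_right i j (Finset.mem_filter.1 hi).2 (Finset.mem_filter.1 hj).2)
    hg
  have h0 : ∫ x, φ 0 x * f x ∂P.fst = 0 := by
    rw [← hf0]
    refine integral_congr_ae ?_
    filter_upwards [h.left_zero] with x hx
    rw [hx, one_mul]
  rw [hf1] at hl
  rw [hg1] at hr
  have hterm : ∀ k, lam k * (∫ x, φ k x * f x ∂P.fst) * ∫ y, ψ k y * g y ∂P.snd ≤
      lam 1 * (((∫ x, φ k x * f x ∂P.fst) ^ 2 + (∫ y, ψ k y * g y ∂P.snd) ^ 2) / 2) := fun k => by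
    have hsq := two_mul_le_add_sq (∫ x, φ k x * f x ∂P.fst) (∫ y, ψ k y * g y ∂P.snd)
    have hn : 0 ≤ ((∫ x, φ k x * f x ∂P.fst) ^ 2 + (∫ y, ψ k y * g y ∂P.snd) ^ 2) / 2 := by
      positivity
    rcases Nat.eq_zero_or_pos k with rfl | hk
    · rw [h0, mul_zero, zero_mul]
      rw [h0] at hn
      exact mul_nonneg (h.lam_nonneg 1) hn
    · rw [mul_assoc]
      refine (mul_le_mul_of_nonneg_left (b := _) (by linarith) (h.lam_nonneg k)).trans
        (mul_le_mul_of_nonneg_right (h.lam_antitone hk) hn)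
  calc ∑ k ∈ Finset.range K, lam k * (∫ x, φ k x * f x ∂P.fst) * ∫ y, ψ k y * g y ∂P.snd
      = ∑ k ∈ Finset.range K with lam k ≠ 0,
          lam k * (∫ x, φ k x * f x ∂P.fst) * ∫ y, ψ k y * g y ∂P.snd := by
        symm
        refine Finset.sum_filter_of_ne fun k _ hk hz => hk ?_
        rw [hz, zero_mul, zero_mul]
    _ ≤ ∑ k ∈ Finset.range K with lam k ≠ 0, lam 1 * (((∫ x, φ k x * f x ∂P.fst) ^ 2 +
          (∫ y, ψ k y * g y ∂P.snd) ^ 2) / 2) := Finset.sum_le_sum fun k _ => hterm k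
    _ = lam 1 * ((∑ k ∈ Finset.range K with lam k ≠ 0, (∫ x, φ k x * f x ∂P.fst) ^ 2 +
          ∑ k ∈ Finset.range K with lam k ≠ 0, (∫ y, ψ k y * g y ∂P.snd) ^ 2) / 2) := by
        rw [← Finset.mul_sum, ← Finset.sum_div, Finset.sum_add_distrib]
    _ ≤ lam 1 * 1 := mul_le_mul_of_nonneg_left (by linarith) (h.lam_nonneg 1)
    _ = lam 1 := mul_one _

theorem IsSingularSystem.maximalCorrelation_le (h : IsSingularSystem P lam φ ψ)
    (hac : P ≪ P.fst.prod P.snd) : maximalCorrelation P ≤ lam 1 := by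
  refine Real.sSup_le ?_ (h.lam_nonneg 1)
  rintro r ⟨f, g, hf, hg, hf0, -, hf1, hg1, rfl⟩
  exact h.integral_mul_le hac hf hg hf0 hf1 hg1

end Spectrum

/-! ### The linear statistic under the null law. -/

section Null

variable {𝒳 𝒴 : Type*} [MeasurableSpace 𝒳] [MeasurableSpace 𝒴]
  {P : Measure (𝒳 × 𝒴)} [IsProbabilityMeasure P]

instance isProbabilityMeasure_nullLaw (n m : ℕ) : IsProbabilityMeasure (nullLaw P n m) := by
  unfold nullLaw
  infer_instance

/-- The linear statistic `a ∑ᵢ φ(Xᵢ) - b ∑ᵢ ψ(Yᵢ)`. -/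
noncomputable def linearStatistic (φ : 𝒳 → ℝ) (ψ : 𝒴 → ℝ) (a b : ℝ) {n m : ℕ}
    (D : (Fin n → 𝒳) × (Fin m → 𝒴)) : ℝ :=
  a * ∑ i, φ (D.1 i) - b * ∑ i, ψ (D.2 i)

variable {φ : 𝒳 → ℝ} {ψ : 𝒴 → ℝ}

theorem measurable_linearStatistic (hφ : Measurable φ) (hψ : Measurable ψ) (a b : ℝ) {n m : ℕ} :
    Measurable (linearStatistic φ ψ a b : (Fin n → 𝒳) × (Fin m → 𝒴) → ℝ) := by
  unfold linearStatistic
  fun_prop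

theorem integral_exp_linearStatistic_nullLaw (φ : 𝒳 → ℝ) (ψ : 𝒴 → ℝ) (a b t : ℝ) (n m : ℕ) :
    ∫ D, Complex.exp ((t * linearStatistic φ ψ a b D : ℝ) * Complex.I) ∂nullLaw P n m =
      (∫ x, Complex.exp ((t * a * φ x : ℝ) * Complex.I) ∂P.fst) ^ n *
      (∫ y, Complex.exp ((t * (-b) * ψ y : ℝ) * Complex.I) ∂P.snd) ^ m := by
  have h : ∀ D : (Fin n → 𝒳) × (Fin m → 𝒴),
      Complex.exp ((t * linearStatistic φ ψ a b D : ℝ) * Complex.I) =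
      (∏ i, Complex.exp ((t * a * φ (D.1 i) : ℝ) * Complex.I)) *
        ∏ i, Complex.exp ((t * (-b) * ψ (D.2 i) : ℝ) * Complex.I) := fun D => by
    rw [← Complex.exp_sum, ← Complex.exp_sum, ← Complex.exp_add, ← Finset.sum_mul,
      ← Finset.sum_mul, ← add_mul, ← Complex.ofReal_sum, ← Complex.ofReal_sum,
      ← Complex.ofReal_add, ← Finset.mul_sum, ← Finset.mul_sum, linearStatistic]
    congr 3
    ring
  simp_rw [h]
  rw [nullLaw, integral_prod_mul (fun x : Fin n → 𝒳 => ∏ i,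
      Complex.exp ((t * a * φ (x i) : ℝ) * Complex.I)) (fun y : Fin m → 𝒴 => ∏ i,
      Complex.exp ((t * (-b) * ψ (y i) : ℝ) * Complex.I)),
    integral_fintype_prod_eq_prod fun _ x => Complex.exp ((t * a * φ x : ℝ) * Complex.I),
    integral_fintype_prod_eq_prod fun _ y => Complex.exp ((t * (-b) * ψ y : ℝ) * Complex.I)]
  simp

theorem norm_integral_exp_mul_I_le_one {Ω : Type*} [MeasurableSpace Ω] {μ : Measure Ω}
    [IsProbabilityMeasure μ] (f : Ω → ℝ) :
    ‖∫ ω, Complex.exp ((f ω : ℝ) * Complex.I) ∂μ‖ ≤ 1 := by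
  refine (norm_integral_le_of_norm_le_const (C := 1) (ae_of_all _ fun ω => ?_)).trans_eq (by simp)
  rw [Complex.norm_exp_ofReal_mul_I]

/-- The factor of the `Y` sample has modulus at most 1, so no moment information on `ψ` is needed.
-/
theorem norm_integral_exp_linearStatistic_le_left (a b t : ℝ) (n m : ℕ) :
    ‖∫ D, Complex.exp ((t * linearStatistic φ ψ a b D : ℝ) * Complex.I) ∂nullLaw P n m‖ ≤
      ‖∫ x, Complex.exp ((t * a * φ x : ℝ) * Complex.I) ∂P.fst‖ ^ n := by
  rw [integral_exp_linearStatistic_nullLaw, norm_mul, norm_pow, norm_pow]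
  exact mul_le_of_le_one_right (by positivity)
    (pow_le_one₀ (norm_nonneg _) (norm_integral_exp_mul_I_le_one _))

theorem norm_integral_exp_linearStatistic_le_right (a b t : ℝ) (n m : ℕ) :
    ‖∫ D, Complex.exp ((t * linearStatistic φ ψ a b D : ℝ) * Complex.I) ∂nullLaw P n m‖ ≤
      ‖∫ y, Complex.exp ((t * (-b) * ψ y : ℝ) * Complex.I) ∂P.snd‖ ^ m := by
  rw [integral_exp_linearStatistic_nullLaw, norm_mul, norm_pow, norm_pow]
  exact mul_le_of_le_one_left (by positivity)
    (pow_le_one₀ (norm_nonneg _) (norm_integral_exp_mul_I_le_one _))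

end Null

/-! ### Second moment of the linear statistic under the planted law. -/

section Planted

variable {𝒳 𝒴 : Type*} [MeasurableSpace 𝒳] [MeasurableSpace 𝒴]
  {P : Measure (𝒳 × 𝒴)} {n m : ℕ}

theorem measurable_assemble (π : Fin m ↪ Fin n) :
    Measurable (assemble π : (Fin m → 𝒳 × 𝒴) × ({j : Fin n // ¬ ∃ i, π i = j} → 𝒳) → _) := by
  refine Measurable.prodMk (measurable_pi_iff.2 fun j => ?_) (by fun_prop)
  by_cases h : ∃ i, π i = j
  · simp only [h, dite_true]
    fun_prop
  · simp only [h, dite_false]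
    fun_prop

theorem sum_assemble_fst {𝒳 𝒴 : Type*} (π : Fin m ↪ Fin n) (f : 𝒳 → ℝ)
    (zw : (Fin m → 𝒳 × 𝒴) × ({j : Fin n // ¬ ∃ i, π i = j} → 𝒳)) :
    ∑ j, f ((assemble π zw).1 j) = ∑ i, f (zw.1 i).1 + ∑ j, f (zw.2 j) := by
  rw [← Fintype.sum_subtype_add_sum_subtype (fun j => ∃ i, π i = j)]
  congr 1
  · let e : Fin m ≃ {j // ∃ i, π i = j} := Equiv.ofInjective π π.injective
    refine (Fintype.sum_equiv e (fun i => f (zw.1 i).1)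
      (fun j : {j // ∃ i, π i = j} => f ((assemble π zw).1 j)) fun i => ?_).symm
    have h : ∃ i', π i' = π i := ⟨i, rfl⟩
    -- Injectivity of `π` makes the preimage chosen inside `assemble` the original index.
    have hc : h.choose = i := π.injective h.choose_spec
    change _ = f ((assemble π zw).1 (π i))
    simp only [assemble]
    rw [dif_pos h, hc]
  · refine Finset.sum_congr rfl fun j _ => ?_
    simp only [assemble]
    rw [dif_neg j.2]

/-- Grouping by matched pairs makes all summands independent under the planted law given `π`, so
that their variances add. -/
theorem linearStatistic_assemble {𝒳 𝒴 : Type*} (φ : 𝒳 → ℝ) (ψ : 𝒴 → ℝ) (a b : ℝ) (π : Fin m ↪ Fin n)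
    (zw : (Fin m → 𝒳 × 𝒴) × ({j : Fin n // ¬ ∃ i, π i = j} → 𝒳)) :
    linearStatistic φ ψ a b (assemble π zw) =
      ∑ i, (a * φ (zw.1 i).1 - b * ψ (zw.1 i).2) + ∑ j, a * φ (zw.2 j) := by
  rw [linearStatistic, sum_assemble_fst, Finset.sum_sub_distrib, ← Finset.mul_sum,
    ← Finset.mul_sum, ← Finset.mul_sum]
  simp only [assemble]
  ring

theorem card_unmatched (π : Fin m ↪ Fin n) :
    Fintype.card {j : Fin n // ¬ ∃ i, π i = j} = n - m := by
  rw [Fintype.card_subtype_compl, Fintype.card_fin]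
  congr 1
  let e : Fin m ≃ {j // ∃ i, π i = j} := Equiv.ofInjective π π.injective
  exact (Fintype.card_congr e).symm.trans (Fintype.card_fin m)

theorem integral_sum_pi_eq_zero {Ω ι : Type*} [MeasurableSpace Ω] [Fintype ι] {μ : Measure Ω}
    [IsProbabilityMeasure μ] {f : Ω → ℝ} (hf : Integrable f μ) (h0 : ∫ ω, f ω ∂μ = 0) :
    ∫ x : ι → Ω, ∑ i, f (x i) ∂Measure.pi (fun _ => μ) = 0 := by
  rw [integral_finsetSum]
  · refine Finset.sum_eq_zero fun i _ => ?_
    rw [integral_comp_eval (μ := fun _ : ι => μ) (i := i) hf.aestronglyMeasurable, h0]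
  · exact fun i _ => integrable_comp_eval (μ := fun _ : ι => μ) hf

theorem memLp_comp_eval_pi {Ω ι : Type*} [MeasurableSpace Ω] [Fintype ι] {μ : Measure Ω}
    [IsProbabilityMeasure μ] {f : Ω → ℝ} (hf : MemLp f 2 μ) (i : ι) :
    MemLp (fun x : ι → Ω => f (x i)) 2 (Measure.pi fun _ => μ) :=
  hf.comp_measurePreserving (measurePreserving_eval (fun _ : ι => μ) i)

theorem variance_sum_comp_eval_pi {Ω ι : Type*} [MeasurableSpace Ω] [Fintype ι] {μ : Measure Ω}
    [IsProbabilityMeasure μ] {f : Ω → ℝ} (hf : MemLp f 2 μ) :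
    Var[fun x : ι → Ω => ∑ i, f (x i); Measure.pi fun _ => μ] = Fintype.card ι * Var[f; μ] := by
  have h := variance_sum_pi (μ := fun _ : ι => μ) (X := fun _ => f) fun _ => hf
  rw [Finset.sum_const, nsmul_eq_mul, Finset.card_univ] at h
  rw [← h]
  congr 1
  ext x
  simp

theorem memLp_comp_fst {f : 𝒳 → ℝ} (hf : MemLp f 2 P.fst) : MemLp (fun z => f z.1) 2 P :=
  hf.comp_measurePreserving ⟨measurable_fst, rfl⟩

theorem memLp_comp_snd {f : 𝒴 → ℝ} (hf : MemLp f 2 P.snd) : MemLp (fun z => f z.2) 2 P :=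
  hf.comp_measurePreserving ⟨measurable_snd, rfl⟩

theorem integral_comp_fst' {f : 𝒳 → ℝ} (hf : Measurable f) :
    ∫ z, f z.1 ∂P = ∫ x, f x ∂P.fst :=
  (integral_map measurable_fst.aemeasurable hf.aestronglyMeasurable).symm

theorem integral_comp_snd' {f : 𝒴 → ℝ} (hf : Measurable f) :
    ∫ z, f z.2 ∂P = ∫ y, f y ∂P.snd :=
  (integral_map measurable_snd.aemeasurable hf.aestronglyMeasurable).symm

variable [IsProbabilityMeasure P] {φ : 𝒳 → ℝ} {ψ : 𝒴 → ℝ}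

/-- Chebyshev bound for the linear statistic under the planted law, given the matching. -/
theorem plantedLawGiven_sq_ge_le (hφ : Measurable φ) (hψ : Measurable ψ) (hφ2 : MemLp φ 2 P.fst)
    (hψ2 : MemLp ψ 2 P.snd) (hφ0 : ∫ x, φ x ∂P.fst = 0) (hψ0 : ∫ y, ψ y ∂P.snd = 0)
    (hφ1 : ∫ x, φ x ^ 2 ∂P.fst = 1) (hψ1 : ∫ y, ψ y ^ 2 ∂P.snd = 1) {l : ℝ}
    (hl : ∫ z, φ z.1 * ψ z.2 ∂P = l) (a b : ℝ) (π : Fin m ↪ Fin n) (hmn : m ≤ n) {τ : ℝ}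
    (hτ : 0 < τ) :
    plantedLawGiven P π {D | τ ≤ linearStatistic φ ψ a b D ^ 2} ≤
      ENNReal.ofReal ((n * a ^ 2 + m * b ^ 2 - 2 * m * a * b * l) / τ) := by
  set ρ := (Measure.pi fun _ : Fin m => P).prod
    (Measure.pi fun _ : {j : Fin n // ¬ ∃ i, π i = j} => P.fst) with hρ
  have hmeas : MeasurableSet {D : (Fin n → 𝒳) × (Fin m → 𝒴) |
      τ ≤ linearStatistic φ ψ a b D ^ 2} :=
    measurableSet_le measurable_const ((measurable_linearStatistic hφ hψ a b).pow_const 2)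
  rw [plantedLawGiven, Measure.map_apply (measurable_assemble π) hmeas]
  set u : 𝒳 × 𝒴 → ℝ := fun z => a * φ z.1 - b * ψ z.2 with hu
  set v : 𝒳 → ℝ := fun x => a * φ x with hv
  have hφP := memLp_comp_fst hφ2
  have hψP := memLp_comp_snd hψ2
  have hu2 : MemLp u 2 P := (hφP.const_mul a).sub (hψP.const_mul b)
  have hv2 : MemLp v 2 P.fst := hφ2.const_mul a
  have hu0 : ∫ z, u z ∂P = 0 := by
    rw [hu, integral_sub ((hφP.integrable (by norm_num)).const_mul a)
      ((hψP.integrable (by norm_num)).const_mul b), integral_const_mul, integral_const_mul,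
      integral_comp_fst' hφ, integral_comp_snd' hψ, hφ0, hψ0]
    ring
  have hv0 : ∫ x, v x ∂P.fst = 0 := by
    rw [hv, integral_const_mul, hφ0, mul_zero]
  have hvarv : Var[v; P.fst] = a ^ 2 := by
    rw [variance_eq_sub hv2, hv0]
    simp only [hv, Pi.pow_apply, mul_pow]
    rw [integral_const_mul, hφ1]
    ring
  have hvaru : Var[u; P] = a ^ 2 + b ^ 2 - 2 * a * b * l := by
    rw [variance_eq_sub hu2, hu0]
    have e : ∀ z, (u ^ 2) z = a ^ 2 * φ z.1 ^ 2 + b ^ 2 * ψ z.2 ^ 2 -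
        2 * a * b * (φ z.1 * ψ z.2) := fun z => by
      simp only [hu, Pi.pow_apply]
      ring
    simp_rw [e]
    rw [integral_sub, integral_add, integral_const_mul, integral_const_mul, integral_const_mul, hl,
      integral_comp_fst' (hφ.pow_const 2), integral_comp_snd' (hψ.pow_const 2), hφ1, hψ1]
    · ring
    · exact hφP.integrable_sq.const_mul _
    · exact hψP.integrable_sq.const_mul _
    · exact (hφP.integrable_sq.const_mul _).add (hψP.integrable_sq.const_mul _)
    · exact (hφP.integrable_mul hψP).const_mul _
  have hF : MemLp (fun z : Fin m → 𝒳 × 𝒴 => ∑ i, u (z i)) 2 (Measure.pi fun _ => P) :=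
    memLp_finsetSum _ fun i _ => memLp_comp_eval_pi hu2 i
  have hG : MemLp (fun w : {j : Fin n // ¬ ∃ i, π i = j} → 𝒳 => ∑ j, v (w j)) 2
      (Measure.pi fun _ => P.fst) :=
    memLp_finsetSum _ fun i _ => memLp_comp_eval_pi hv2 i
  -- The `m` pairs contribute `a² + b² - 2abl` each and the `n - m` unmatched points `a²` each.
  have hvar := variance_add_prod hF hG
  rw [variance_sum_comp_eval_pi hu2, variance_sum_comp_eval_pi hv2, hvaru, hvarv, card_unmatched,
    Fintype.card_fin, Nat.cast_sub hmn] at hvar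
  have hFρ := hF.comp_fst (Measure.pi fun _ : {j : Fin n // ¬ ∃ i, π i = j} => P.fst)
  have hGρ := hG.comp_snd (Measure.pi fun _ : Fin m => P)
  have hmean : ∫ zw, (∑ i, u (zw.1 i) + ∑ j, v (zw.2 j)) ∂ρ = 0 := by
    rw [integral_add (hFρ.integrable (by norm_num)) (hGρ.integrable (by norm_num)),
      integral_fun_fst (fun z : Fin m → 𝒳 × 𝒴 => ∑ i, u (z i)),
      integral_fun_snd (fun w : {j : Fin n // ¬ ∃ i, π i = j} → 𝒳 => ∑ j, v (w j)),
      integral_sum_pi_eq_zero (hu2.integrable (by norm_num)) hu0,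
      integral_sum_pi_eq_zero (hv2.integrable (by norm_num)) hv0]
    simp
  have hcheb := meas_ge_le_variance_div_sq (hFρ.add hGρ) (Real.sqrt_pos.2 hτ)
  refine (measure_mono fun zw hzw => ?_).trans (hcheb.trans_eq ?_)
  · have hzw' : τ ≤ linearStatistic φ ψ a b (assemble π zw) ^ 2 := hzw
    rw [linearStatistic_assemble] at hzw'
    change √τ ≤ |(∑ i, u (zw.1 i) + ∑ j, v (zw.2 j)) -
      ∫ zw, (∑ i, u (zw.1 i) + ∑ j, v (zw.2 j)) ∂ρ|
    rw [hmean, sub_zero]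
    exact Real.le_sqrt_of_sq_le (by rw [Real.sq_sqrt hτ.le]; exact hzw') |>.trans_eq
      (Real.sqrt_sq_eq_abs _)
  · rw [Real.sq_sqrt hτ.le]
    congr 2
    refine Eq.trans ?_ (hvar.trans (by ring))
    rfl

/-- The bound given `π` does not depend on `π`, so it survives averaging. -/
theorem plantedLaw_sq_ge_le (hφ : Measurable φ) (hψ : Measurable ψ) (hφ2 : MemLp φ 2 P.fst)
    (hψ2 : MemLp ψ 2 P.snd) (hφ0 : ∫ x, φ x ∂P.fst = 0) (hψ0 : ∫ y, ψ y ∂P.snd = 0)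
    (hφ1 : ∫ x, φ x ^ 2 ∂P.fst = 1) (hψ1 : ∫ y, ψ y ^ 2 ∂P.snd = 1) {l : ℝ}
    (hl : ∫ z, φ z.1 * ψ z.2 ∂P = l) (a b : ℝ) (hmn : m ≤ n) {τ : ℝ} (hτ : 0 < τ) :
    plantedLaw P n m {D | τ ≤ linearStatistic φ ψ a b D ^ 2} ≤
      ENNReal.ofReal ((n * a ^ 2 + m * b ^ 2 - 2 * m * a * b * l) / τ) := by
  rw [plantedLaw, Measure.smul_apply, Measure.finsetSum_apply, smul_eq_mul]
  calc (Fintype.card (Fin m ↪ Fin n) : ℝ≥0∞)⁻¹ *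
        ∑ π : Fin m ↪ Fin n, plantedLawGiven P π {D | τ ≤ linearStatistic φ ψ a b D ^ 2}
      ≤ (Fintype.card (Fin m ↪ Fin n) : ℝ≥0∞)⁻¹ * ∑ _π : Fin m ↪ Fin n,
          ENNReal.ofReal ((n * a ^ 2 + m * b ^ 2 - 2 * m * a * b * l) / τ) := by
        gcongr with π
        exact plantedLawGiven_sq_ge_le hφ hψ hφ2 hψ2 hφ0 hψ0 hφ1 hψ1 hl a b π hmn hτ
    _ ≤ 1 * ENNReal.ofReal ((n * a ^ 2 + m * b ^ 2 - 2 * m * a * b * l) / τ) := by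
        rw [Finset.sum_const, nsmul_eq_mul, Finset.card_univ, ← mul_assoc]
        gcongr
        exact ENNReal.inv_mul_le_one _
    _ = _ := one_mul _

end Planted

/-! ### Choice of thresholds and asymptotics. -/

section Detection

theorem integrable_abs_pow_three {Ω : Type*} [MeasurableSpace Ω] {μ : Measure Ω} {f : Ω → ℝ}
    (hf : Measurable f) (h : thirdAbsMoment μ f ≠ ∞) :
    Integrable (fun ω => |f ω| ^ 3) μ := by
  refine ⟨(by fun_prop), ?_⟩
  rw [hasFiniteIntegral_iff_enorm]
  simp only [enorm_pow, ← Real.norm_eq_abs, enorm_norm]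
  exact h.lt_top

theorem integral_abs_pow_three {Ω : Type*} [MeasurableSpace Ω] {μ : Measure Ω} {f : Ω → ℝ}
    (hf : Measurable f) : ∫ ω, |f ω| ^ 3 ∂μ = (thirdAbsMoment μ f).toReal := by
  have h := integral_norm_eq_lintegral_enorm (μ := μ) (f := fun ω => |f ω| ^ 3)
    (Measurable.aestronglyMeasurable (by fun_prop))
  simp only [enorm_pow, norm_pow, ← Real.norm_eq_abs, enorm_norm, norm_norm] at h
  exact h

/-- The extended-valued moment condition allows infinite moments, but only at finitely many `n`. -/
theorem eventually_ne_top_of_tendsto_div_sqrt {β : ℕ → ℝ≥0∞} {k : ℕ → ℕ}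
    (h : Tendsto (fun n => β n / ENNReal.ofReal (√(k n : ℝ))) atTop (𝓝 0)) :
    ∀ᶠ n in atTop, β n ≠ ∞ := by
  filter_upwards [h.eventually (gt_mem_nhds ENNReal.zero_lt_top)] with n hn htop
  rw [htop, ENNReal.top_div_of_ne_top ENNReal.ofReal_ne_top] at hn
  exact lt_irrefl _ hn

theorem tendsto_toReal_add_one_div_sqrt {β : ℕ → ℝ≥0∞} {k : ℕ → ℕ}
    (hk : Tendsto (fun n => (k n : ℝ)) atTop atTop)
    (h : Tendsto (fun n => β n / ENNReal.ofReal (√(k n : ℝ))) atTop (𝓝 0)) :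
    Tendsto (fun n => ((β n).toReal + 1) / √(k n : ℝ)) atTop (𝓝 0) := by
  have h1 := (ENNReal.tendsto_toReal ENNReal.zero_ne_top).comp h
  have h2 : Tendsto (fun n => (√(k n : ℝ))⁻¹) atTop (𝓝 0) :=
    (Real.tendsto_sqrt_atTop.comp hk).inv_tendsto_atTop
  have h3 := h1.add h2
  rw [ENNReal.toReal_zero, add_zero] at h3
  refine h3.congr fun n => ?_
  rw [Function.comp_apply, ENNReal.toReal_div, ENNReal.toReal_ofReal (Real.sqrt_nonneg _), add_div,
    one_div]

variable {𝒳 𝒴 : ℕ → Type*} [∀ n, MeasurableSpace (𝒳 n)] [∀ n, MeasurableSpace (𝒴 n)]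
  {P : ∀ n, Measure (𝒳 n × 𝒴 n)} [∀ n, IsProbabilityMeasure (P n)] {m : ℕ → ℕ}

/-- Strong detection from a small ball bound under the null and a second moment bound under the
alternative. -/
theorem achievesStrongDetection_of_bounds {T : ∀ n, (Fin n → 𝒳 n) × (Fin (m n) → 𝒴 n) → ℝ}
    {C : ℝ} {ε r : ℕ → ℝ} (hε0 : ∀ᶠ n in atTop, 0 ≤ ε n) (hr0 : ∀ n, 0 ≤ r n)
    (hε : Tendsto ε atTop (𝓝 0)) (hr : Tendsto r atTop (𝓝 0)) (hC : 0 ≤ C)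
    (hnull : ∀ᶠ n in atTop, ∀ τ : ℝ, 0 < τ → (nullLaw (P n) n (m n)).real {D | T n D < τ} ≤
      C * (√(3 * τ / 2) + 16 * r n ^ 2 / τ))
    (halt : ∀ᶠ n in atTop, ∀ τ : ℝ, 0 < τ → plantedLaw (P n) n (m n) {D | τ ≤ T n D} ≤
      ENNReal.ofReal (ε n / τ)) :
    AchievesStrongDetection P m T := by
  -- The first term gives `ε / τ ≤ √ε`, the second `r² / τ ≤ r`, and the third only keeps `τ`
  -- positive.
  set τ : ℕ → ℝ := fun n => √(ε n) + r n + 1 / ((n : ℝ) + 1) with hτdef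
  have hsε : Tendsto (fun n => √(ε n)) atTop (𝓝 0) := by
    simpa [Function.comp_def] using (Real.continuous_sqrt.tendsto 0).comp hε
  have hτ : Tendsto τ atTop (𝓝 0) := by
    simpa [hτdef] using (hsε.add hr).add tendsto_one_div_add_atTop_nhds_zero_nat
  have hpos : ∀ n : ℕ, 0 < 1 / ((n : ℝ) + 1) := fun n => by positivity
  have hτ0 : ∀ n, 0 < τ n := fun n => by
    have := Real.sqrt_nonneg (ε n)
    have := hr0 n
    have := hpos n
    simp only [hτdef]
    linarith
  refine ⟨τ, ?_, ?_⟩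
  · have hlim : Tendsto (fun n => C * (√(3 * τ n / 2) + 16 * r n)) atTop (𝓝 0) := by
      have h1 : Tendsto (fun n => √(3 * τ n / 2)) atTop (𝓝 0) := by
        have h := (Real.continuous_sqrt.tendsto (3 * 0 / 2)).comp
          ((hτ.const_mul 3).div_const 2)
        rwa [mul_zero, zero_div, Real.sqrt_zero] at h
      simpa using (h1.add (hr.const_mul 16)).const_mul C
    have hlim' := (ENNReal.continuous_ofReal.tendsto 0).comp hlim
    rw [ENNReal.ofReal_zero] at hlim'
    refine tendsto_of_tendsto_of_tendsto_of_le_of_le' tendsto_const_nhds hlim'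
      (Eventually.of_forall fun _ => zero_le) ?_
    filter_upwards [hnull] with n hn
    rw [← ofReal_measureReal]
    refine ENNReal.ofReal_le_ofReal ((hn (τ n) (hτ0 n)).trans ?_)
    have hrτ : r n ≤ τ n := by
      have := Real.sqrt_nonneg (ε n)
      have := hpos n
      simp only [hτdef]
      linarith
    have : 16 * r n ^ 2 / τ n ≤ 16 * r n := by
      rw [div_le_iff₀ (hτ0 n)]
      nlinarith [hr0 n]
    exact mul_le_mul_of_nonneg_left (add_le_add le_rfl this) hC
  · have hlim' := (ENNReal.continuous_ofReal.tendsto 0).comp hsε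
    rw [ENNReal.ofReal_zero] at hlim'
    refine tendsto_of_tendsto_of_tendsto_of_le_of_le' tendsto_const_nhds hlim'
      (Eventually.of_forall fun _ => zero_le) ?_
    filter_upwards [halt, hε0] with n hn h0
    refine (hn (τ n) (hτ0 n)).trans (ENNReal.ofReal_le_ofReal ?_)
    rw [div_le_iff₀ (hτ0 n)]
    have h1 : √(ε n) ≤ τ n := by
      have := hr0 n
      have := hpos n
      simp only [hτdef]
      linarith
    calc ε n = √(ε n) * √(ε n) := (Real.mul_self_sqrt h0).symm
      _ ≤ √(ε n) * τ n := by gcongr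

theorem tendsto_natCast_atTop_of_div_tendsto_one
    (hmn : Tendsto (fun n => (m n : ℝ) / (n : ℝ)) atTop (𝓝 1)) :
    Tendsto (fun n => (m n : ℝ)) atTop atTop := by
  refine (hmn.pos_mul_atTop one_pos tendsto_natCast_atTop_atTop).congr' ?_
  filter_upwards [eventually_gt_atTop 0] with n hn
  have : (n : ℝ) ≠ 0 := by exact_mod_cast hn.ne'
  field_simp

end Detection

end BrokenSample

/-! ### The main theorem. -/

open BrokenSample in
theorem mainTheorem7 {𝒳 𝒴 : ℕ → Type*} [∀ n, MeasurableSpace (𝒳 n)]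
    [∀ n, MeasurableSpace (𝒴 n)]
    (P : ∀ n, Measure (𝒳 n × 𝒴 n)) [∀ n, IsProbabilityMeasure (P n)]
    (m : ℕ → ℕ) (hm : ∀ n, m n ≤ n)
    (hmn : Tendsto (fun n => (m n : ℝ) / (n : ℝ)) atTop (𝓝 1))
    (hchi : ∀ n, BrokenSample.chiSqInfo (P n) < ∞)
    (lam : ℕ → ℕ → ℝ) (φ : ∀ n, ℕ → 𝒳 n → ℝ) (ψ : ∀ n, ℕ → 𝒴 n → ℝ)
    (hsvd : ∀ n, BrokenSample.IsSingularSystem (P n) (lam n) (φ n) (ψ n))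
    (hmoment :
      Tendsto (fun n : ℕ => BrokenSample.thirdAbsMoment (P n).fst (φ n 1) /
        ENNReal.ofReal (√(n : ℝ))) atTop (𝓝 0) ∨
      Tendsto (fun n : ℕ => BrokenSample.thirdAbsMoment (P n).snd (ψ n 1) /
        ENNReal.ofReal (√(m n : ℝ))) atTop (𝓝 0))
    (hrho : Tendsto (fun n => BrokenSample.maximalCorrelation (P n)) atTop (𝓝 1)) :
    BrokenSample.AchievesStrongDetection P m
      (fun n => BrokenSample.topStatistic (φ n 1) (ψ n 1) n (m n)) := by
  have hac := fun n => absolutelyContinuous_of_chiSqInfo_lt_top (hchi n)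
  have hlam : Tendsto (fun n => lam n 1) atTop (𝓝 1) :=
    tendsto_of_tendsto_of_tendsto_of_le_of_le hrho tendsto_const_nhds
      (fun n => (hsvd n).maximalCorrelation_le (hac n)) fun n => (hsvd n).lam_le_one 1
  -- Only when `λ₁ ≠ 0` are `φ₁` and `ψ₁` known to be centred and normalised.
  have hlam0 : ∀ᶠ n in atTop, lam n 1 ≠ 0 := hlam.eventually_ne one_ne_zero
  have hmtop := tendsto_natCast_atTop_of_div_tendsto_one hmn
  have hmpos : ∀ᶠ n in atTop, 0 < m n := by
    filter_upwards [hmtop.eventually_gt_atTop 0] with n hn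
    exact_mod_cast hn
  -- This is the planted variance for `a = 1 / √n` and `b = 1 / √m`, where `m a b = √(m / n)`.
  have hε : Tendsto (fun n => 2 - 2 * (√((m n : ℝ) / n) * lam n 1)) atTop (𝓝 0) := by
    have h1 : Tendsto (fun n => √((m n : ℝ) / n)) atTop (𝓝 1) := by
      have h := (Real.continuous_sqrt.tendsto 1).comp hmn
      rwa [Real.sqrt_one] at h
    have h2 := ((h1.mul hlam).const_mul 2).const_sub 2
    rwa [mul_one, mul_one, sub_self] at h2
  have hε0 : ∀ n, 0 ≤ 2 - 2 * (√((m n : ℝ) / n) * lam n 1) := fun n => by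
    have h1 : √((m n : ℝ) / n) ≤ 1 :=
      Real.sqrt_le_one.2 (div_le_one_of_le₀ (by exact_mod_cast hm n) (Nat.cast_nonneg n))
    have h2 := mul_le_one₀ h1 ((hsvd n).lam_nonneg 1) ((hsvd n).lam_le_one 1)
    linarith
  have halt : ∀ᶠ n in atTop, ∀ τ : ℝ, 0 < τ → plantedLaw (P n) n (m n)
      {D | τ ≤ topStatistic (φ n 1) (ψ n 1) n (m n) D} ≤
      ENNReal.ofReal ((2 - 2 * (√((m n : ℝ) / n) * lam n 1)) / τ) := by
    filter_upwards [hlam0, hmpos] with n hl hmn0 τ hτ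
    have h := hsvd n
    refine (plantedLaw_sq_ge_le (h.measurable_left 1) (h.measurable_right 1) (h.memLp_left 1)
      (h.memLp_right 1) (h.integral_left hl) (h.integral_right hl) (h.integral_sq_left hl)
      (h.integral_sq_right hl) (h.integral_top_mul_top (hac n) hl) (√(n : ℝ))⁻¹ (√(m n : ℝ))⁻¹
      (hm n) hτ).trans_eq ?_
    have hm0 : (0 : ℝ) < m n := by exact_mod_cast hmn0
    have hn0 : (0 : ℝ) < n := by exact_mod_cast hmn0.trans_le (hm n)
    have hsm := Real.sqrt_pos.2 hm0
    have hsn := Real.sqrt_pos.2 hn0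
    congr 2
    rw [inv_pow, inv_pow, Real.sq_sqrt hm0.le, Real.sq_sqrt hn0.le, mul_inv_cancel₀ hm0.ne',
      mul_inv_cancel₀ hn0.ne', Real.sqrt_div hm0.le]
    nth_rewrite 1 [← Real.mul_self_sqrt hm0.le]
    field_simp
    ring
  have hsq : ∀ k : ℕ, ((√(k : ℝ))⁻¹) ^ 2 = (k : ℝ)⁻¹ := fun k => by
    rw [inv_pow, Real.sq_sqrt (Nat.cast_nonneg k)]
  rcases hmoment with hmom | hmom
  · refine achievesStrongDetection_of_bounds (Eventually.of_forall hε0) (fun n => ?_) hε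
      (tendsto_toReal_add_one_div_sqrt tendsto_natCast_atTop_atTop hmom)
      (Real.exp_pos (1 / 2)).le ?_ halt
    · positivity
    · filter_upwards [hlam0, eventually_gt_atTop 0,
        eventually_ne_top_of_tendsto_div_sqrt (k := fun n => n) hmom] with n hl hn htop τ hτ
      have h := hsvd n
      rw [← integral_abs_pow_three (h.measurable_left 1)]
      exact measureReal_sq_lt_le_of_charFun_le_pow
        (measurable_linearStatistic (h.measurable_left 1) (h.measurable_right 1) _ _)
        (h.measurable_left 1) (h.memLp_left 1)
        (integrable_abs_pow_three (h.measurable_left 1) htop) (h.integral_left hl)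
        (h.integral_sq_left hl) hn (hsq n)
        (fun t => norm_integral_exp_linearStatistic_le_left _ _ t _ _) hτ
  · refine achievesStrongDetection_of_bounds (Eventually.of_forall hε0) (fun n => ?_) hε
      (tendsto_toReal_add_one_div_sqrt hmtop hmom) (Real.exp_pos (1 / 2)).le ?_ halt
    · positivity
    · filter_upwards [hlam0, hmpos, eventually_ne_top_of_tendsto_div_sqrt hmom]
        with n hl hn htop τ hτ
      have h := hsvd n
      rw [← integral_abs_pow_three (h.measurable_right 1)]
      exact measureReal_sq_lt_le_of_charFun_le_pow
        (measurable_linearStatistic (h.measurable_left 1) (h.measurable_right 1) _ _)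
        (h.measurable_right 1) (h.memLp_right 1)
        (integrable_abs_pow_three (h.measurable_right 1) htop) (h.integral_right hl)
        -- The `Y` sum enters with coefficient `-1 / √m`; only its square matters.
        (h.integral_sq_right hl) hn ((neg_sq _).trans (hsq (m n)))
        (fun t => norm_integral_exp_linearStatistic_le_right _ _ t _ _) hτ
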